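/- Let $q(x,y)$ be a positive definite binary quadratic form with integer coefficients. Let $\Delta<0$ be its discriminant ($\beta^2-4\alpha\gamma$ for a form $\alpha x^2+\beta xy+\gamma y^2$) and $\kappa$ its content, i.e. the greatest common divisor of its three coefficients. Write $q':=\frac1\kappa q=[a,b,c]:=ax^2+bxy+cy^2$ and $\Delta':=\operatorname{disc}(q')=\Delta/\kappa^2$. View $\mathbb{Q}(\sqrt{\Delta'})$ as a subfield of $\mathbb{C}$ via $\sqrt{\Delta'}=i\sqrt{|\Delta'|}$, and let $L\subset\mathbb{Q}(\sqrt{\Delta'})$ be the lattice with $\mathbb{Z}$-basis $\{a,(b+\sqrt{\Delta'})/2\}$. Let $\mathcal{O}_\Delta=\mathbb{Z}+\mathbb{Z}\frac{\Delta+\sqrt{\Delta}}2$ be the quadratic order of discriminant $\Delta$, and consider the complex elliptic curves $E=\mathbb{C}/\mathcal{O}_\Delta$ and $E'=\mathbb{C}/L$. Then $E'$ is isogenous to $E$. Moreover, the degree map $q_{E,E'}:\operatorname{Hom}(E,E')\to\mathbb{Z}$, $h\mapsto\deg(h)$ (with $\deg(0)=0$), is a quadratic form on the $\mathbb{Z}$-module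 $\operatorname{Hom}(E,E')$, and it is equivalent over $\mathbb{Z}$ to $q$: there is an isomorphism of abelian groups $e:\mathbb{Z}^2\to\operatorname{Hom}(E,E')$ such that $\deg(e(x,y))=q(x,y)$ for all $x,y\in\mathbb{Z}$. -/

import Mathlib

noncomputable section

namespace DegreeForm

/-! ### Integral binary quadratic forms -/

/-- The integral binary quadratic form `[a, b, c] = a x² + b x y + c y²`. -/
@[ext] structure BinForm where
  a : ℤ
  b : ℤ
  c : ℤ

namespace BinForm

/-- The form `[a, b, c]` as a quadratic form on the `ℤ`-module `ℤ²`. -/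
def toQuadraticForm (q : BinForm) : QuadraticForm ℤ (Fin 2 → ℤ) :=
  q.a • QuadraticMap.proj 0 0 + q.b • QuadraticMap.proj 0 1 + q.c • QuadraticMap.proj 1 1

theorem toQuadraticForm_apply (q : BinForm) (v : Fin 2 → ℤ) :
    q.toQuadraticForm v = q.a * v 0 ^ 2 + q.b * (v 0 * v 1) + q.c * v 1 ^ 2 := by
  simp [toQuadraticForm, sq]

/-- Positive definiteness: `q(v) > 0` for every non-zero `v ∈ ℤ²`. -/
def IsPosDef (q : BinForm) : Prop := q.toQuadraticForm.PosDef

/-- The discriminant `b² - 4ac`. -/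
def disc (q : BinForm) : ℤ := q.b ^ 2 - 4 * q.a * q.c

/-- The content: the greatest common divisor of the coefficients. -/
def content (q : BinForm) : ℕ := Int.gcd q.a (Int.gcd q.b q.c)

/-- The form `q / cont(q)`; the divisions are exact, see `content_mul_primitivePart`. -/
def primitivePart (q : BinForm) : BinForm where
  a := q.a / q.content
  b := q.b / q.content
  c := q.c / q.content

theorem content_mul_primitivePart (q : BinForm) :
    q.content * q.primitivePart.a = q.a ∧ q.content * q.primitivePart.b = q.b ∧
      q.content * q.primitivePart.c = q.c := by
  have h : ((Int.gcd q.b q.c : ℕ) : ℤ) ∣ q.b ∧ ((Int.gcd q.b q.c : ℕ) : ℤ) ∣ q.c :=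
    ⟨Int.gcd_dvd_left .., Int.gcd_dvd_right ..⟩
  have h1 : (q.content : ℤ) ∣ q.a := Int.gcd_dvd_left ..
  have h2 : (q.content : ℤ) ∣ (Int.gcd q.b q.c : ℕ) := Int.gcd_dvd_right ..
  exact ⟨Int.mul_ediv_cancel' h1, Int.mul_ediv_cancel' (h2.trans h.1),
    Int.mul_ediv_cancel' (h2.trans h.2)⟩

theorem disc_eq (q : BinForm) : q.disc = q.content ^ 2 * q.primitivePart.disc := by
  obtain ⟨ha, hb, hc⟩ := q.content_mul_primitivePart
  unfold disc
  rw [← ha, ← hb, ← hc]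
  simp only [primitivePart]
  ring

theorem IsPosDef.a_pos {q : BinForm} (hq : q.IsPosDef) : 0 < q.a := by
  have h := hq ![1, 0] (by intro h; simpa using congrFun h 0)
  simpa [toQuadraticForm_apply] using h

theorem IsPosDef.disc_neg {q : BinForm} (hq : q.IsPosDef) : q.disc < 0 := by
  have ha := hq.a_pos
  have h := hq ![-q.b, 2 * q.a] (by
    intro h
    have := congrFun h 1
    simp at this
    omega)
  simp only [toQuadraticForm_apply, Matrix.cons_val_zero, Matrix.cons_val_one] at h
  unfold disc
  have : 0 < q.a * -(q.b ^ 2 - 4 * q.a * q.c) := by linarith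
  have := (mul_pos_iff_of_pos_left ha).1 this
  linarith

theorem IsPosDef.primitivePart {q : BinForm} (hq : q.IsPosDef) :
    q.primitivePart.IsPosDef := by
  intro v hv
  have h := hq v hv
  obtain ⟨ha, hb, hc⟩ := q.content_mul_primitivePart
  rw [toQuadraticForm_apply, ← ha, ← hb, ← hc] at h
  rw [toQuadraticForm_apply]
  refine pos_of_mul_pos_right (a := (q.content : ℤ)) ?_ (Int.natCast_nonneg _)
  linarith

end BinForm

/-! ### Lattices in imaginary quadratic fields -/

/-- The square root `i √|D|` of a negative integer `D`. -/
def sqrtDisc (D : ℤ) : ℂ := Complex.I * (Real.sqrt (-(D : ℝ)) : ℝ)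

theorem sqrtDisc_sq {D : ℤ} (hD : D < 0) : sqrtDisc D ^ 2 = D := by
  have h : (0 : ℝ) ≤ -(D : ℝ) := by
    have : (D : ℝ) < 0 := by exact_mod_cast hD
    linarith
  rw [sqrtDisc, mul_pow, Complex.I_sq, ← Complex.ofReal_pow, Real.sq_sqrt h]
  simp

theorem linearIndependent_sqrtDisc {D : ℤ} (hD : D < 0) {a : ℤ} (ha : a ≠ 0) (b : ℤ) :
    LinearIndependent ℝ ![(a : ℂ), ((b : ℂ) + sqrtDisc D) / 2] := by
  have h : (0 : ℝ) < -(D : ℝ) := by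
    have : (D : ℝ) < 0 := by exact_mod_cast hD
    linarith
  have hs : Real.sqrt (-(D : ℝ)) ≠ 0 := (Real.sqrt_pos.2 h).ne'
  rw [LinearIndependent.pair_iff]
  intro x y hxy
  have him := congrArg Complex.im hxy
  have hre := congrArg Complex.re hxy
  simp [sqrtDisc, hs] at him
  subst him
  simp [ha] at hre
  exact ⟨hre, rfl⟩

/-- The `ℤ`-basis `{1, (D + √D) / 2}` of the quadratic order of discriminant `D < 0`. -/
def orderPeriods (D : ℤ) (hD : D < 0) : PeriodPair where
  ω₁ := 1
  ω₂ := ((D : ℂ) + sqrtDisc D) / 2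
  indep := by simpa using linearIndependent_sqrtDisc hD one_ne_zero D

/-- The lattice of `orderPeriods D` is the ring `𝓞_D = ℤ[(D + √D) / 2]`, the order of
discriminant `D`, when `D` is a discriminant. -/
theorem orderPeriods_lattice (D : ℤ) (hD : D < 0) (hD4 : D % 4 = 0 ∨ D % 4 = 1) :
    (orderPeriods D hD).lattice =
      Subalgebra.toSubmodule (Algebra.adjoin ℤ {((D : ℂ) + sqrtDisc D) / 2}) := by
  have key : ∃ m : ℤ, D ^ 2 - D = 4 * m := by
    obtain ⟨k, hk⟩ : ∃ k, D = 4 * k ∨ D = 4 * k + 1 := ⟨D / 4, by omega⟩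
    rcases hk with hk | hk
    · exact ⟨4 * k ^ 2 - k, by rw [hk]; ring⟩
    · exact ⟨4 * k ^ 2 + k, by rw [hk]; ring⟩
  obtain ⟨m, hm⟩ := key
  have hmC : (D : ℂ) ^ 2 - D = 4 * m := by exact_mod_cast hm
  have hs := sqrtDisc_sq hD
  apply le_antisymm
  · rw [PeriodPair.lattice, Submodule.span_le]
    rintro x (rfl | rfl)
    · exact one_mem (Algebra.adjoin ℤ _)
    · exact Algebra.subset_adjoin rfl
  · intro x hx
    refine Algebra.adjoin_induction (p := fun x _ => x ∈ (orderPeriods D hD).lattice)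
      ?_ ?_ ?_ ?_ hx
    · rintro y rfl
      exact PeriodPair.ω₂_mem_lattice _
    · intro r
      exact PeriodPair.mem_lattice.2 ⟨r, 0, by simp [orderPeriods]⟩
    · intro y z _ _ hy hz
      exact add_mem hy hz
    · intro y z _ _ hy hz
      obtain ⟨y₁, y₂, rfl⟩ := PeriodPair.mem_lattice.1 hy
      obtain ⟨z₁, z₂, rfl⟩ := PeriodPair.mem_lattice.1 hz
      refine PeriodPair.mem_lattice.2
        ⟨y₁ * z₁ - y₂ * z₂ * m, y₁ * z₂ + y₂ * z₁ + y₂ * z₂ * D, ?_⟩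
      simp only [orderPeriods]
      push_cast
      linear_combination (-(y₂ : ℂ) * z₂ / 4) * hs + (y₂ : ℂ) * z₂ / 4 * hmC

/-- The basis `{a, (b + √D) / 2}`, `D = b² - 4ac`, of the lattice in `ℚ(√D) ⊆ ℂ` attached to a
positive definite form `[a, b, c]`. -/
def BinForm.periods (q : BinForm) (hq : q.IsPosDef) : PeriodPair where
  ω₁ := q.a
  ω₂ := ((q.b : ℂ) + sqrtDisc q.disc) / 2
  indep := linearIndependent_sqrtDisc hq.disc_neg hq.a_pos.ne' q.b

/-! ### Complex elliptic curves, homomorphisms, degrees -/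

/-- The complex elliptic curve `ℂ / Λ` as a group, `Λ` being the lattice of the period pair. -/
abbrev Torus (P : PeriodPair) : Type := ℂ ⧸ P.lattice

/-- A map `φ : ℂ / Λ → ℂ / Λ'` is holomorphic for the quotient complex structures: near every
point of `ℂ`, the composite `ℂ → ℂ / Λ → ℂ / Λ'` lifts to a holomorphic function. -/
def IsHolomorphic {P P' : PeriodPair} (φ : Torus P → Torus P') : Prop :=
  ∀ z : ℂ, ∃ U : Set ℂ, IsOpen U ∧ z ∈ U ∧ ∃ f : ℂ → ℂ, DifferentiableOn ℂ f U ∧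
    ∀ w ∈ U, φ (P.lattice.mkQ w) = P'.lattice.mkQ (f w)

/-- `Hom(E, E')` for `E = ℂ / Λ`, `E' = ℂ / Λ'`: the group of holomorphic group
homomorphisms. -/
def Hom (P P' : PeriodPair) : AddSubgroup (Torus P →+ Torus P') where
  carrier := {φ | IsHolomorphic φ}
  zero_mem' := fun _ => ⟨Set.univ, isOpen_univ, trivial, fun _ => 0,
    differentiableOn_const 0, fun _ _ => by simp⟩
  add_mem' := by
    intro φ ψ hφ hψ z
    obtain ⟨U, hU, hzU, f, hf, hfφ⟩ := hφ z
    obtain ⟨V, hV, hzV, g, hg, hgψ⟩ := hψ z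
    refine ⟨U ∩ V, hU.inter hV, ⟨hzU, hzV⟩, f + g,
      (hf.mono Set.inter_subset_left).add (hg.mono Set.inter_subset_right), ?_⟩
    intro w hw
    rw [AddMonoidHom.add_apply, hfφ w hw.1, hgψ w hw.2, Pi.add_apply, map_add]
  neg_mem' := by
    intro φ hφ z
    obtain ⟨U, hU, hzU, f, hf, hfφ⟩ := hφ z
    refine ⟨U, hU, hzU, -f, hf.neg, ?_⟩
    intro w hw
    rw [AddMonoidHom.neg_apply, hfφ w hw, Pi.neg_apply, map_neg]

/-- An isogeny is a surjective homomorphism with finite kernel. -/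
def IsIsogeny {P P' : PeriodPair} (φ : Hom P P') : Prop :=
  Function.Surjective φ.1 ∧ Finite φ.1.ker

/-- `ℂ / Λ` is isogenous to `ℂ / Λ'`. -/
def Isogenous (P P' : PeriodPair) : Prop := ∃ φ : Hom P P', IsIsogeny φ

open Classical in
/-- The degree of a homomorphism of elliptic curves: `0` for the zero homomorphism, and the order
of the kernel for a non-zero one (an isogeny). -/
def degree {P P' : PeriodPair} (φ : Hom P P') : ℕ :=
  if φ = 0 then 0 else Nat.card φ.1.ker

/-- `Q` is the degree form of `(ℂ / Λ, ℂ / Λ')`: the quadratic form on the `ℤ`-module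
`Hom(ℂ / Λ, ℂ / Λ')` whose values are the degrees. -/
def IsDegreeForm {P P' : PeriodPair} (Q : QuadraticForm ℤ (Hom P P')) : Prop :=
  ∀ φ : Hom P P', Q φ = (degree φ : ℤ)

end DegreeForm

end

noncomputable section

namespace DegreeForm

/-! Write `κ` for the content, `ω = (b + √Δ')/2`, `O` for the order of discriminant `Δ`. A
holomorphic homomorphism of tori lifts to multiplication by some `α` with `αΛ ⊆ Λ'`
(`exists_eq_mulHom`). For `Λ = O`, `Λ' = L` this forces `α = α·1 ∈ L`; conversely `L` is stable
under `O`, because `ω² = bω - ac` and `O` is spanned by `1` and `m + κω`. So `Hom(E, E')` is `L`, a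
copy of `ℤ²` (`homEquiv`). The degree of `α` is the index of `αΛ` in `Λ'`, the absolute value of a
determinant in the periods (`card_ker_mulHom`). For `α = xa + yω` that determinant is `κ(ax² + bxy +
cy²) = q(x, y)` (`degree_homEquiv`). -/

variable {P P' : PeriodPair}

/-! ### Homomorphisms of complex tori are multiplications -/

/-- The homomorphism `ℂ / Λ → ℂ / Λ'` induced by multiplication by `α`, where `α Λ ⊆ Λ'`. -/
def mulHom (P P' : PeriodPair) (α : ℂ) (h : ∀ l ∈ P.lattice, α * l ∈ P'.lattice) : Hom P P' :=
  ⟨(P.lattice.mapQ P'.lattice (LinearMap.mulLeft ℤ α) h).toAddMonoidHom, fun _ =>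
    ⟨Set.univ, isOpen_univ, trivial, fun z => α * z,
      (differentiable_id.const_mul α).differentiableOn, fun _ _ => rfl⟩⟩

theorem mulHom_mkQ (α : ℂ) (h : ∀ l ∈ P.lattice, α * l ∈ P'.lattice) (z : ℂ) :
    (mulHom P P' α h).1 (P.lattice.mkQ z) = P'.lattice.mkQ (α * z) := rfl

theorem hom_ext {φ ψ : Hom P P'} (h : ∀ z, φ.1 (P.lattice.mkQ z) = ψ.1 (P.lattice.mkQ z)) :
    φ = ψ := by
  apply Subtype.ext
  ext t
  obtain ⟨z, rfl⟩ := P.lattice.mkQ_surjective t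
  exact h z

theorem mkQ_eq_iff {z w : ℂ} : P.lattice.mkQ z = P.lattice.mkQ w ↔ z - w ∈ P.lattice := by
  simpa using Submodule.Quotient.eq P.lattice

/-- Non-zero lattice vectors are bounded away from `0`. -/
theorem exists_pos_forall_norm_lt (P : PeriodPair) :
    ∃ δ > 0, ∀ l ∈ P.lattice, ‖l‖ < δ → l = 0 := by
  have h := P.compl_lattice_sdiff_singleton_mem_nhds 0
  obtain ⟨δ, hδ, hb⟩ := Metric.mem_nhds_iff.1 h
  refine ⟨δ, hδ, fun l hl hn => ?_⟩
  by_contra h0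
  exact hb (by simpa using hn) ⟨hl, h0⟩

theorem eq_zero_of_forall_mul_mem {α : ℂ} (h : ∀ z, α * z ∈ P.lattice) : α = 0 := by
  by_contra h0
  have := h (P.ω₁ / 2 / α)
  rw [mul_div_cancel₀ _ h0] at this
  exact P.ω₁_div_two_notMem_lattice this

theorem mulHom_injective {α β : ℂ} {h : ∀ l ∈ P.lattice, α * l ∈ P'.lattice}
    {h' : ∀ l ∈ P.lattice, β * l ∈ P'.lattice} (hab : mulHom P P' α h = mulHom P P' β h') :
    α = β := by
  refine sub_eq_zero.1 (eq_zero_of_forall_mul_mem (P := P') fun z => ?_)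
  rw [sub_mul]
  refine mkQ_eq_iff.1 ?_
  rw [← mulHom_mkQ α h, hab, mulHom_mkQ]

/-- A function with `g (2w) = 2 g(w)` near `0` that is differentiable at `0` is linear there. -/
theorem eq_deriv_mul_of_double {g : ℂ → ℂ} {r : ℝ} (hg : DifferentiableAt ℂ g 0)
    (hd : ∀ w, ‖w‖ < r → g (2 * w) = 2 * g w) (z : ℂ) (hz : ‖z‖ < r) :
    g z = deriv g 0 * z := by
  have hr : 0 < r := (norm_nonneg z).trans_lt hz
  have h0 : g 0 = 0 := by
    have := hd 0 (by simpa using hr)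
    rw [mul_zero] at this
    linear_combination -this
  by_cases hz0 : z = 0
  · simp [hz0, h0]
  have hn : ∀ n : ℕ, g z = 2 ^ n * g (z / 2 ^ n) := by
    intro n
    induction n with
    | zero => simp
    | succ n ih =>
      have : ‖z / 2 ^ (n + 1)‖ < r := by
        rw [norm_div, norm_pow]
        refine (div_le_self (norm_nonneg z) ?_).trans_lt hz
        exact one_le_pow₀ (by norm_num)
      have h2 := hd _ this
      have h3 : 2 * (z / 2 ^ (n + 1)) = z / 2 ^ n := by
        rw [pow_succ]
        field_simp
      rw [h3] at h2
      rw [ih, h2]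
      ring
  have hslope := hasDerivAt_iff_tendsto_slope.1 hg.hasDerivAt
  have hlim : Filter.Tendsto (fun n : ℕ => z / (2 : ℂ) ^ n) Filter.atTop (nhdsWithin 0 {0}ᶜ) := by
    refine tendsto_nhdsWithin_iff.2 ⟨?_, Filter.Eventually.of_forall fun n => by simp [hz0]⟩
    have := (tendsto_pow_atTop_nhds_zero_of_norm_lt_one
      (x := (1 / 2 : ℂ)) (by norm_num)).const_mul z
    simpa [div_eq_mul_inv] using this
  have hc := hslope.comp hlim
  have hconst : (slope g 0 ∘ fun n : ℕ => z / (2 : ℂ) ^ n) = fun _ => g z / z := by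
    funext n
    -- By `hn`, the slope from `0` to `z / 2 ^ n` does not depend on `n`; its limit is the
    -- derivative.
    simp only [Function.comp, slope_def_field, h0, sub_zero]
    rw [hn n]
    field_simp
  rw [hconst] at hc
  have := tendsto_nhds_unique hc tendsto_const_nhds
  rw [this, div_mul_cancel₀ _ hz0]

/-- Every homomorphism of complex tori is induced by multiplication by a complex number. -/
theorem exists_eq_mulHom (φ : Hom P P') :
    ∃ (α : ℂ) (h : ∀ l ∈ P.lattice, α * l ∈ P'.lattice), φ = mulHom P P' α h := by
  obtain ⟨U, hU, h0U, f, hf, hφ⟩ := φ.2 0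
  obtain ⟨δ, hδ, hsep⟩ := exists_pos_forall_norm_lt P'
  set g : ℂ → ℂ := fun z => f z - f 0 with hg
  have hf0 : P'.lattice.mkQ (f 0) = 0 := by
    rw [← hφ 0 h0U, map_zero, map_zero]
  have hgφ : ∀ w ∈ U, φ.1 (P.lattice.mkQ w) = P'.lattice.mkQ (g w) := by
    intro w hw
    rw [hφ w hw, hg, map_sub, hf0, sub_zero]
  have hfd : DifferentiableAt ℂ f 0 := hf.differentiableAt (hU.mem_nhds h0U)
  have hgd : DifferentiableAt ℂ g 0 := hfd.sub_const _
  have hcont : ContinuousAt (fun w => g (2 * w) - 2 * g w) 0 := by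
    have h2 : ContinuousAt (fun w : ℂ => 2 * w) 0 := by fun_prop
    have h1 : ContinuousAt g (2 * 0) := by simpa using hgd.continuousAt
    exact (ContinuousAt.comp (f := fun w : ℂ => 2 * w) h1 h2).sub
      (hgd.continuousAt.const_mul 2)
  have hsmall : ∀ᶠ w in nhds (0 : ℂ), ‖g (2 * w) - 2 * g w‖ < δ := by
    have := hcont.norm.eventually_lt (f := fun w => ‖g (2 * w) - 2 * g w‖)
      (continuousAt_const (y := δ)) (by simpa [hg] using hδ)
    exact this
  have hU1 : ∀ᶠ w in nhds (0 : ℂ), w ∈ U := hU.mem_nhds h0U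
  have hU2 : ∀ᶠ w in nhds (0 : ℂ), 2 * w ∈ U := by
    have h2 : ContinuousAt (fun w : ℂ => 2 * w) 0 := by fun_prop
    exact h2.eventually_mem (by simpa using hU.mem_nhds h0U)
  obtain ⟨r, hr, hb⟩ := Metric.eventually_nhds_iff.1 (hsmall.and (hU1.and hU2))
  have hd : ∀ w, ‖w‖ < r → g (2 * w) = 2 * g w := by
    intro w hw
    obtain ⟨h1, h2, h3⟩ := hb (by simpa using hw)
    -- Additivity of `φ` puts `g (2w) - 2 g(w)` in the lattice; being shorter than `δ`, it vanishes.
    refine sub_eq_zero.1 (hsep _ (mkQ_eq_iff.1 ?_) h1)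
    rw [← hgφ _ h3, two_mul, two_mul, map_add, map_add, map_add, hgφ w h2]
  have hlin := eq_deriv_mul_of_double hgd hd
  set α := deriv g 0
  have hall : ∀ z, φ.1 (P.lattice.mkQ z) = P'.lattice.mkQ (α * z) := by
    intro z
    -- Linearity spreads from the disc to all of `ℂ`: `z / n` lies in the disc, and `φ` commutes
    -- with multiplication by `n`.
    obtain ⟨n, hn⟩ := exists_nat_gt (‖z‖ / r)
    have hn0 : (0 : ℝ) < n := lt_of_le_of_lt (by positivity) hn
    have hnC : (n : ℂ) ≠ 0 := by exact_mod_cast hn0.ne'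
    have hlt : ‖z / n‖ < r := by
      rw [norm_div, Complex.norm_natCast, div_lt_iff₀ hn0]
      rwa [div_lt_iff₀ hr, mul_comm] at hn
    have hz : z = n • (z / n) := by
      rw [nsmul_eq_mul]
      field_simp
    rw [hz, map_nsmul, map_nsmul, hgφ _ (hb (by simpa using hlt)).2.1, hlin _ hlt, ← map_nsmul,
      mul_smul_comm]
  have hα : ∀ l ∈ P.lattice, α * l ∈ P'.lattice := by
    intro l hl
    have h1 := hall l
    rw [Submodule.mkQ_apply, (Submodule.Quotient.mk_eq_zero _).2 hl, map_zero] at h1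
    exact (Submodule.Quotient.mk_eq_zero _).1 h1.symm
  exact ⟨α, hα, hom_ext hall⟩

/-! ### Degrees as determinants -/

/-- Multiplication by `α` maps `Λ` into `Λ'` as soon as it does so on the periods. -/
theorem mul_mem_of_periods {α : ℂ} (h₁ : α * P.ω₁ ∈ P'.lattice) (h₂ : α * P.ω₂ ∈ P'.lattice) :
    ∀ l ∈ P.lattice, α * l ∈ P'.lattice := by
  intro l hl
  obtain ⟨m, n, rfl⟩ := PeriodPair.mem_lattice.1 hl
  have : α * (m * P.ω₁ + n * P.ω₂) = m • (α * P.ω₁) + n • (α * P.ω₂) := by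
    simp only [zsmul_eq_mul]
    ring
  rw [this]
  exact add_mem (zsmul_mem h₁ m) (zsmul_mem h₂ n)

/-- The kernel of multiplication by `α` has order `|det|`, where `det` is the determinant of
multiplication by `α` with respect to the periods. -/
theorem card_ker_mulHom {α : ℂ} (hα : α ≠ 0) (h : ∀ l ∈ P.lattice, α * l ∈ P'.lattice)
    {s t u v : ℤ} (h₁ : α * P.ω₁ = s * P'.ω₁ + t * P'.ω₂)
    (h₂ : α * P.ω₂ = u * P'.ω₁ + v * P'.ω₂) :
    Nat.card (mulHom P P' α h).1.ker = (s * v - t * u).natAbs := by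
  -- Division by `α` maps `Λ'` onto the kernel `α⁻¹Λ' / Λ`, and its own kernel is `αΛ`. The order
  -- sought is thus the index of `αΛ` in `Λ'`.
  let g : P'.lattice →+ Torus P :=
    P.lattice.mkQ.toAddMonoidHom.comp
      ((AddMonoidHom.mulLeft α⁻¹).comp P'.lattice.subtype.toAddMonoidHom)
  have hg : ∀ l, g l = P.lattice.mkQ (α⁻¹ * l) := fun _ => rfl
  have hrange : g.range = (mulHom P P' α h).1.ker := by
    ext x
    obtain ⟨z, rfl⟩ := P.lattice.mkQ_surjective x
    rw [AddMonoidHom.mem_ker, mulHom_mkQ, Submodule.mkQ_apply, Submodule.mkQ_apply,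
      Submodule.Quotient.mk_eq_zero]
    constructor
    · rintro ⟨l, hl⟩
      have h1 := h _ (mkQ_eq_iff.1 ((hg l).symm.trans hl))
      rw [mul_sub, mul_inv_cancel_left₀ hα] at h1
      simpa using sub_mem l.2 h1
    · intro hz
      exact ⟨⟨α * z, hz⟩, by rw [hg, inv_mul_cancel_left₀ hα]; rfl⟩
  have hker : ∀ l, l ∈ g.ker ↔ α⁻¹ * l ∈ P.lattice := by
    intro l
    rw [AddMonoidHom.mem_ker, hg, Submodule.mkQ_apply, Submodule.Quotient.mk_eq_zero]
  -- Multiplication by `α` carries the periods of `Λ` to a basis of `αΛ`, as the index formula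
  -- requires.
  let e : P.lattice ≃+ g.ker :=
    { toFun := fun l => ⟨⟨α * l, h l l.2⟩, (hker _).2 (by simp [inv_mul_cancel_left₀ hα])⟩
      invFun := fun l => ⟨α⁻¹ * l.1, (hker _).1 l.2⟩
      left_inv := fun l => Subtype.ext (by simp [inv_mul_cancel_left₀ hα])
      right_inv := fun l => Subtype.ext (Subtype.ext (by simp [mul_inv_cancel_left₀ hα]))
      map_add' := fun l m => Subtype.ext (Subtype.ext (by simp [mul_add])) }
  have hidx := AddSubgroup.index_eq_natAbs_det P'.latticeBasis g.ker
    (P.latticeBasis.map e.toIntLinearEquiv)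
  rw [← hrange, ← AddSubgroup.index_ker, hidx]
  have hb : (fun i => ((P.latticeBasis.map e.toIntLinearEquiv i : g.ker) : P'.lattice)) =
      ![s • P'.latticeBasis 0 + t • P'.latticeBasis 1,
        u • P'.latticeBasis 0 + v • P'.latticeBasis 1] := by
    funext i
    apply Subtype.ext
    fin_cases i
    · simpa [e] using h₁
    · simpa [e] using h₂
  rw [hb, Module.Basis.det_apply, Matrix.det_fin_two]
  simp [Module.Basis.toMatrix_apply, mul_comm]

theorem surjective_mulHom {α : ℂ} (hα : α ≠ 0) (h : ∀ l ∈ P.lattice, α * l ∈ P'.lattice) :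
    Function.Surjective (mulHom P P' α h).1 := by
  intro x
  obtain ⟨z, rfl⟩ := P'.lattice.mkQ_surjective x
  exact ⟨P.lattice.mkQ (α⁻¹ * z), by rw [mulHom_mkQ, mul_inv_cancel_left₀ hα]⟩

/-! ### The lattices attached to the form -/

theorem BinForm.content_pos {q : BinForm} (hq : q.IsPosDef) : 0 < q.content := by
  have h := q.content_mul_primitivePart.1
  have ha := hq.a_pos
  rcases Nat.eq_zero_or_pos q.content with h0 | h0
  · rw [h0] at h
    simp at h
    omega
  · exact h0

theorem sqrtDisc_sq_mul (k : ℕ) (D : ℤ) : sqrtDisc ((k : ℤ) ^ 2 * D) = k * sqrtDisc D := by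
  have : (-(((k : ℤ) ^ 2 * D : ℤ) : ℝ)) = (k : ℝ) ^ 2 * -(D : ℝ) := by push_cast; ring
  rw [sqrtDisc, sqrtDisc, this, Real.sqrt_mul (sq_nonneg _), Real.sqrt_sq (Nat.cast_nonneg k)]
  push_cast
  ring

/-- The constant term is a multiple of `ω₁ = a`, which is why the lattice is stable under
multiplication by `ω₂`. -/
theorem periods_ω₂_sq (p : BinForm) (hp : p.IsPosDef) :
    (p.periods hp).ω₂ ^ 2 = p.b * (p.periods hp).ω₂ - p.a * p.c := by
  have hs := sqrtDisc_sq hp.disc_neg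
  have hd : ((p.disc : ℤ) : ℂ) = (p.b : ℂ) ^ 2 - 4 * p.a * p.c := by
    rw [BinForm.disc]; push_cast; ring
  rw [hd] at hs
  simp only [BinForm.periods]
  linear_combination hs / 4

/-- With `κ` the content, `(Δ + √Δ) / 2 = m + κ (b + √Δ') / 2` for an integer `m`. -/
theorem exists_orderPeriods_ω₂_eq (q : BinForm) (hq : q.IsPosDef) :
    ∃ m : ℤ, (orderPeriods q.disc hq.disc_neg).ω₂ =
      m + q.content * (q.primitivePart.periods hq.primitivePart).ω₂ := by
  obtain ⟨m, hm⟩ : ∃ m : ℤ, q.disc - q.b = 2 * m := by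
    -- `Δ - b = b(b - 1) - 4ac`, with the coefficients of `q` itself, is even.
    obtain ⟨k, hk⟩ := Int.even_mul_pred_self q.b
    refine ⟨k - 2 * q.a * q.c, ?_⟩
    rw [BinForm.disc]
    linear_combination hk
  refine ⟨m, ?_⟩
  have hmC : (q.disc : ℂ) - q.b = 2 * m := by exact_mod_cast hm
  have hs : sqrtDisc q.disc = q.content * sqrtDisc q.primitivePart.disc := by
    rw [q.disc_eq, sqrtDisc_sq_mul]
  have hb : (q.content : ℂ) * q.primitivePart.b = q.b := by
    exact_mod_cast q.content_mul_primitivePart.2.1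
  simp only [orderPeriods, BinForm.periods]
  rw [hs]
  linear_combination hmC / 2 - hb / 2

/-- Multiplication by the content works: its matrix in the periods is triangular with determinant
`q.a > 0`. -/
theorem isogenous_orderPeriods (q : BinForm) (hq : q.IsPosDef) :
    Isogenous (q.primitivePart.periods hq.primitivePart) (orderPeriods q.disc hq.disc_neg) := by
  obtain ⟨m, hm⟩ := exists_orderPeriods_ω₂_eq q hq
  have hκ := BinForm.content_pos hq
  have hα : (q.content : ℂ) ≠ 0 := by exact_mod_cast hκ.ne'
  have h₁ : (q.content : ℂ) * (q.primitivePart.periods hq.primitivePart).ω₁ =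
      (q.a : ℤ) * (orderPeriods q.disc hq.disc_neg).ω₁ +
        (0 : ℤ) * (orderPeriods q.disc hq.disc_neg).ω₂ := by
    have : (q.content : ℂ) * q.primitivePart.a = q.a := by
      exact_mod_cast q.content_mul_primitivePart.1
    simpa [BinForm.periods, orderPeriods] using this
  have h₂ : (q.content : ℂ) * (q.primitivePart.periods hq.primitivePart).ω₂ =
      (-m : ℤ) * (orderPeriods q.disc hq.disc_neg).ω₁ +
        (1 : ℤ) * (orderPeriods q.disc hq.disc_neg).ω₂ := by
    rw [hm]
    simp [orderPeriods]
  have h := mul_mem_of_periods (PeriodPair.mem_lattice.2 ⟨_, _, h₁.symm⟩)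
    (PeriodPair.mem_lattice.2 ⟨_, _, h₂.symm⟩)
  refine ⟨mulHom _ _ _ h, surjective_mulHom hα h, ?_⟩
  apply Nat.finite_of_card_ne_zero
  rw [card_ker_mulHom hα h h₁ h₂]
  have := hq.a_pos
  simp
  omega

/-! ### The group `Hom(E, E')` and its degree form -/

/-- The element `v₀ a + v₁ (b + √D) / 2` of the lattice attached to `[a, b, c]`. -/
def BinForm.latticeElement (p : BinForm) (hp : p.IsPosDef) : (Fin 2 → ℤ) →+ ℂ where
  toFun v := v 0 * (p.periods hp).ω₁ + v 1 * (p.periods hp).ω₂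
  map_zero' := by simp
  map_add' v w := by
    simp only [Pi.add_apply, Int.cast_add]
    ring

theorem BinForm.latticeElement_apply (p : BinForm) (hp : p.IsPosDef) (v : Fin 2 → ℤ) :
    p.latticeElement hp v = v 0 * (p.periods hp).ω₁ + v 1 * (p.periods hp).ω₂ := rfl

theorem BinForm.latticeElement_injective (p : BinForm) (hp : p.IsPosDef) :
    Function.Injective (p.latticeElement hp) := by
  rw [injective_iff_map_eq_zero]
  intro v hv
  have h := LinearIndependent.pair_iff.1 (p.periods hp).indep (v 0) (v 1)
    (by simpa [BinForm.latticeElement_apply] using hv)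
  funext i
  fin_cases i
  · exact_mod_cast h.1
  · exact_mod_cast h.2

/-- This is the second row of the matrix of multiplication by the lattice element; the first row is
`v`, since the first period of the order is `1`. -/
theorem latticeElement_mul_order (q : BinForm) (hq : q.IsPosDef) {m : ℤ}
    (hm : (orderPeriods q.disc hq.disc_neg).ω₂ =
      m + q.content * (q.primitivePart.periods hq.primitivePart).ω₂) (v : Fin 2 → ℤ) :
    q.primitivePart.latticeElement hq.primitivePart v * (orderPeriods q.disc hq.disc_neg).ω₂ =
      (v 0 * m - q.content * q.primitivePart.c * v 1 : ℤ) *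
          (q.primitivePart.periods hq.primitivePart).ω₁ +
        (v 1 * m + q.content * (q.primitivePart.a * v 0 + q.primitivePart.b * v 1) : ℤ) *
          (q.primitivePart.periods hq.primitivePart).ω₂ := by
  have hsq := periods_ω₂_sq q.primitivePart hq.primitivePart
  have h1 : (q.primitivePart.periods hq.primitivePart).ω₁ = q.primitivePart.a := rfl
  rw [hm, BinForm.latticeElement_apply, h1]
  push_cast
  linear_combination (v 1 : ℂ) * q.content * hsq

theorem latticeElement_mul_mem (q : BinForm) (hq : q.IsPosDef) (v : Fin 2 → ℤ) :
    ∀ l ∈ (orderPeriods q.disc hq.disc_neg).lattice,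
      q.primitivePart.latticeElement hq.primitivePart v * l ∈
        (q.primitivePart.periods hq.primitivePart).lattice := by
  obtain ⟨m, hm⟩ := exists_orderPeriods_ω₂_eq q hq
  refine mul_mem_of_periods (PeriodPair.mem_lattice.2 ⟨v 0, v 1, ?_⟩)
    (PeriodPair.mem_lattice.2 ⟨_, _, (latticeElement_mul_order q hq hm v).symm⟩)
  simp [BinForm.latticeElement_apply, orderPeriods]

/-- The isomorphism `ℤ² ≃ Hom(E, E')` sending `v` to multiplication by the corresponding element
of the lattice of `E'`. -/
def homEquiv (q : BinForm) (hq : q.IsPosDef) :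
    (Fin 2 → ℤ) ≃+ Hom (orderPeriods q.disc hq.disc_neg)
      (q.primitivePart.periods hq.primitivePart) :=
  AddEquiv.ofBijective
    (AddMonoidHom.mk' (fun v => mulHom _ _ _ (latticeElement_mul_mem q hq v)) fun v w =>
      hom_ext fun z => by
        rw [AddSubgroup.coe_add, AddMonoidHom.add_apply, mulHom_mkQ, mulHom_mkQ, mulHom_mkQ,
          map_add, add_mul, map_add])
    ⟨fun v w hvw => BinForm.latticeElement_injective _ _ (mulHom_injective hvw), fun φ => by
      obtain ⟨α, h, rfl⟩ := exists_eq_mulHom φ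
      -- The first period of the order is `1`, so `α` itself lies in the target lattice.
      obtain ⟨x, y, hxy⟩ := PeriodPair.mem_lattice.1 (h _ (PeriodPair.ω₁_mem_lattice _))
      refine ⟨![x, y], ?_⟩
      have : α = q.primitivePart.latticeElement hq.primitivePart ![x, y] := by
        simpa [BinForm.latticeElement_apply, orderPeriods] using hxy.symm
      subst this
      rfl⟩

theorem homEquiv_apply (q : BinForm) (hq : q.IsPosDef) (v : Fin 2 → ℤ) :
    homEquiv q hq v = mulHom _ _ _ (latticeElement_mul_mem q hq v) := rfl

theorem degree_homEquiv (q : BinForm) (hq : q.IsPosDef) (v : Fin 2 → ℤ) :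
    (degree (homEquiv q hq v) : ℤ) = q.toQuadraticForm v := by
  by_cases hv : v = 0
  · subst hv
    simp [degree]
  have hne : homEquiv q hq v ≠ 0 := by simpa using hv
  have hα : q.primitivePart.latticeElement hq.primitivePart v ≠ 0 := fun h0 =>
    hv (BinForm.latticeElement_injective _ _ (h0.trans (map_zero _).symm))
  obtain ⟨m, hm⟩ := exists_orderPeriods_ω₂_eq q hq
  have hpos := hq v hv
  obtain ⟨ha, hb, hc⟩ := q.content_mul_primitivePart
  rw [degree, if_neg hne, homEquiv_apply, card_ker_mulHom hα _ (s := v 0) (t := v 1)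
    (by simp [BinForm.latticeElement_apply, orderPeriods]) (latticeElement_mul_order q hq hm v)]
  -- The terms in `m` cancel, and multiplying by the content turns the primitive form back into `q`.
  have : v 0 * (v 1 * m + q.content * (q.primitivePart.a * v 0 + q.primitivePart.b * v 1)) -
      v 1 * (v 0 * m - q.content * q.primitivePart.c * v 1) = q.toQuadraticForm v := by
    rw [BinForm.toQuadraticForm_apply]
    linear_combination (v 0 ^ 2) * ha + (v 0 * v 1) * hb + (v 1 ^ 2) * hc
  -- Positive definiteness removes the absolute value.
  rw [this, Int.natAbs_of_nonneg hpos.le]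

end DegreeForm

end

/-- Let `q` be a positive definite binary form, `q / cont(q) = [a, b, c]`, `Δ = disc(q)`,
`Δ' = disc(q / cont(q))`. With `E = ℂ / 𝓞_Δ` and `E' = ℂ / L`, where `L` is the lattice with basis
`{a, (b + √Δ') / 2}`, the curve `E'` is isogenous to `E`, the degree map on `Hom(E, E')` is a
quadratic form, and this form is equivalent to `q` over `ℤ`. -/
theorem mainTheorem5 (q : DegreeForm.BinForm) (hq : q.IsPosDef) :
    DegreeForm.Isogenous (q.primitivePart.periods hq.primitivePart)
        (DegreeForm.orderPeriods q.disc hq.disc_neg) ∧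
      ∃ Q : QuadraticForm ℤ (DegreeForm.Hom (DegreeForm.orderPeriods q.disc hq.disc_neg)
          (q.primitivePart.periods hq.primitivePart)),
        DegreeForm.IsDegreeForm Q ∧ QuadraticMap.Equivalent Q q.toQuadraticForm := by
  -- `Q` is `q` transported along `homEquiv`, so the equivalence is definitional and only the degree
  -- identity needs proof.
  refine ⟨DegreeForm.isogenous_orderPeriods q hq,
    q.toQuadraticForm.comp (DegreeForm.homEquiv q hq).symm.toIntLinearEquiv.toLinearMap, ?_, ?_⟩
  · intro φ
    obtain ⟨v, rfl⟩ := (DegreeForm.homEquiv q hq).surjective φ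
    rw [DegreeForm.degree_homEquiv]
    simp
  · exact ⟨⟨(DegreeForm.homEquiv q hq).symm.toIntLinearEquiv, fun _ => rfl⟩⟩
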